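/- Let $m\ge 2$ be an integer, let $e_m(z)=e^{2\pi i z/m}$, and for an integer $x$ coprime to $m$ let $x^*$ denote the multiplicative inverse of $x$ modulo $m$. Let $a$ be an integer with $\gcd(a,m)=1$, let $N_1,N_2$ be positive integers, and let $\alpha_1(x_1)$ $(1\le x_1\le N_1)$ and $\alpha_2(x_2)$ $(1\le x_2\le N_2)$ be complex numbers with $|\alpha_1(x_1)|\le 1$ and $|\alpha_2(x_2)|\le 1$. Then for all positive integers $k_1,k_2$, $$\Biggl|\sum_{\substack{1\le x_1\le N_1\\ \gcd(x_1,m)=1}}\ \sum_{\substack{1\le x_2\le N_2\\ \gcd(x_2,m)=1}}\alpha_1(x_1)\alpha_2(x_2)\,e_m(a x_1^*x_2^*)\Biggr| < (2k_1)^{\frac{45k_1^2}{k_2}}(2k_2)^{\frac{45k_2^2}{k_1}}(\log m)^{2\left(\frac{k_1}{k_2}+\frac{k_2}{k_1}\right)}\left(\frac{N_1^{k_1-1}}{m^{1/2}}+\frac{m^{1/2}}{N_1^{k_1}}\right)^{\frac{1}{2k_1k_2}}\left(\frac{N_2^{k_2-1}}{m^{1/2}}+\frac{m^{1/2}}{N_2^{k_2}}\right)^{\frac{1}{2k_1k_2}}N_1N_2.$$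 -/

import Mathlib

/-- `e_m(z) = exp(2πiz/m)` for an integer `z`. -/
noncomputable def eMod (m : ℕ) (z : ℤ) : ℂ :=
  Complex.exp (2 * (Real.pi : ℂ) * Complex.I * (z : ℂ) / (m : ℂ))

/-- The representative `x^*` in `{0, …, m-1}` of the inverse of `x` modulo `m`; it is only used
for `x` coprime to `m`. -/
def invMod (m x : ℕ) : ℕ := ((x : ZMod m)⁻¹).val

/-- The set of integers `x` in the interval `[1, N]` that are coprime to `m`. -/
def coprimeInterval (m N : ℕ) : Finset ℕ := (Finset.Icc 1 N).filter (fun x => Nat.Coprime x m)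

/-- The bilinear Kloosterman sum of `α₁(x₁) α₂(x₂) e_m(a x₁^* x₂^*)` over `x₁ ∈ [1, N₁]` and
`x₂ ∈ [1, N₂]`, both variables being restricted to integers coprime to `m`. -/
noncomputable def bilinearKloosterman (m : ℕ) (a : ℤ) (N₁ N₂ : ℕ) (α₁ α₂ : ℕ → ℂ) : ℂ :=
  ∑ x₁ ∈ coprimeInterval m N₁, ∑ x₂ ∈ coprimeInterval m N₂,
    α₁ x₁ * α₂ x₂ * eMod m (a * (invMod m x₁ : ℤ) * (invMod m x₂ : ℤ))

/-!
Hölder's inequality in each variable and the orthogonality of additive characters bound a power of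
the bilinear sum by the numbers of solutions of `∑ xᵢ^* ≡ ∑ yᵢ^* (mod m)` in `k₁`- and `k₂`-tuples.
If two tuples have congruent sums of inverses, the real numbers `∑ 1/xᵢ` and `∑ 1/yᵢ` either agree
or differ by at least `m / (common denominator)`, so each residue class meets few real values and
it remains to count solutions of `∑ 1/xᵢ = ∑ 1/yᵢ`. In such a solution every prime divides
`∏ xᵢ ∏ yᵢ` either not at all or at least twice. Splitting each prime power into squares and cubes
parametrizes the solutions by one integer for each pair or triple of variables, and Rankin's trick
counts these. For `N ≥ m` the trivial bound on the number of solutions suffices.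
-/

section Collisions

open Finset

variable {A G H : Type*} [DecidableEq G] [DecidableEq H]

/-- The number of ordered pairs of elements of `s` on which `U` takes the same value, i.e. the
second moment of the fibre sizes of `U`; it counts the solutions of the equation `U x = U y`. -/
def collisionCount (s : Finset A) (U : A → G) : ℕ :=
  #{p ∈ s ×ˢ s | U p.1 = U p.2}

theorem collisionCount_eq_sum_sq {s : Finset A} {U : A → G} {t : Finset G}
    (h : Set.MapsTo U s t) : collisionCount s U = ∑ c ∈ t, #{x ∈ s | U x = c} ^ 2 := by
  rw [collisionCount, card_eq_sum_card_fiberwise (f := fun p : A × A => U p.1) (t := t)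
    fun p hp => h (mem_product.1 (mem_filter.1 hp).1).1]
  refine sum_congr rfl fun c _ => ?_
  rw [sq, ← card_product]
  congr 1
  ext ⟨x, y⟩
  simp only [mem_filter, mem_product]
  grind

theorem sq_card_le_card_image_mul_collisionCount (s : Finset A) (V : A → H) :
    #s ^ 2 ≤ #(s.image V) * collisionCount s V := by
  rw [collisionCount_eq_sum_sq (Set.mapsTo_iff_image_subset.2 (coe_image (s := s)).ge),
    card_eq_sum_card_image V s]
  exact sq_sum_le_card_mul_sum_sq

theorem sum_collisionCount_fiber_le (s : Finset A) (U : A → G) (V : A → H) :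
    ∑ c ∈ s.image U, collisionCount {x ∈ s | U x = c} V ≤ collisionCount s V := by
  classical
  unfold collisionCount
  rw [← card_biUnion fun c _ d _ hcd => disjoint_left.2 fun p hp hq => hcd (by grind)]
  refine card_le_card fun p hp => ?_
  simp only [mem_biUnion, mem_filter, mem_product] at hp ⊢
  grind

theorem collisionCount_le_mul {s : Finset A} {U : A → G} {V : A → H} {K : ℝ}
    (hK : ∀ c ∈ s.image U, (#({x ∈ s | U x = c}.image V) : ℝ) ≤ K) :
    (collisionCount s U : ℝ) ≤ K * collisionCount s V := by
  rcases s.eq_empty_or_nonempty with rfl | ⟨x, hx⟩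
  · simp [collisionCount]
  have hK_nonneg : 0 ≤ K := (Nat.cast_nonneg _).trans (hK _ (mem_image_of_mem U hx))
  rw [collisionCount_eq_sum_sq (Set.mapsTo_iff_image_subset.2 (coe_image (s := s)).ge)]
  push_cast
  calc ∑ c ∈ s.image U, (#{x ∈ s | U x = c} : ℝ) ^ 2
      ≤ ∑ c ∈ s.image U, K * collisionCount {x ∈ s | U x = c} V := by
        refine sum_le_sum fun c hc => ?_
        refine le_trans ?_ (mul_le_mul_of_nonneg_right (hK c hc) (Nat.cast_nonneg _))
        exact_mod_cast sq_card_le_card_image_mul_collisionCount {x ∈ s | U x = c} V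
    _ ≤ K * collisionCount s V := by
        rw [← mul_sum]
        gcongr
        exact_mod_cast sum_collisionCount_fiber_le s U V

/-- The additive energy of order `k` of the family `u` over `s`: the number of solutions of
`u x₁ + ⋯ + u x_k = u y₁ + ⋯ + u y_k` with all variables in `s`. -/
def sumEnergy [AddCommMonoid G] (k : ℕ) (s : Finset A) (u : A → G) : ℕ :=
  collisionCount (Fintype.piFinset fun _ : Fin k => s) fun p => ∑ i, u (p i)

theorem sumEnergy_isUnit_mul {R : Type*} [Semiring R] [DecidableEq R] {a : R} (ha : IsUnit a)
    (k : ℕ) (s : Finset A) (u : A → R) :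
    sumEnergy k s (fun x => a * u x) = sumEnergy k s u := by
  unfold sumEnergy collisionCount
  simp_rw [← mul_sum, ha.mul_right_inj]

theorem sumEnergy_succ_le [AddCancelCommMonoid G] {s : Finset A} {u : A → G} {K : ℕ}
    (hK : ∀ c, #{x ∈ s | u x = c} ≤ K) (n : ℕ) :
    sumEnergy (n + 1) s u ≤ K * #s ^ (2 * n + 1) := by
  classical
  set S := Fintype.piFinset fun _ : Fin (n + 1) => s with hS
  set P := {p ∈ S ×ˢ S | ∑ i, u (p.1 i) = ∑ i, u (p.2 i)} with hP
  have mem_P : ∀ p ∈ P, (∀ i, p.1 i ∈ s) ∧ (∀ i, p.2 i ∈ s) ∧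
      u (p.1 0) + ∑ i, u (Fin.tail p.1 i) = ∑ i, u (p.2 i) := fun p hp => by
    simpa [hP, hS, and_assoc, Fin.sum_univ_succ (fun i => u (p.1 i)), Fin.tail] using hp
  let dropHead (p : (Fin (n + 1) → A) × (Fin (n + 1) → A)) := (Fin.tail p.1, p.2)
  have card_image : #(P.image dropHead) ≤ #s ^ (2 * n + 1) := by
    have : P.image dropHead ⊆
        (Fintype.piFinset fun _ : Fin n => s) ×ˢ Fintype.piFinset fun _ : Fin (n + 1) => s := by
      refine image_subset_iff.2 fun p hp => mem_product.2 ⟨?_, ?_⟩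
      · exact Fintype.mem_piFinset.2 fun i => (mem_P p hp).1 i.succ
      · exact Fintype.mem_piFinset.2 (mem_P p hp).2.1
    refine (card_le_card this).trans_eq ?_
    simp only [card_product, Fintype.card_piFinset_const]
    ring
  refine (card_le_mul_card_image (f := dropHead) P K fun r hr => ?_).trans
    (Nat.mul_le_mul_left K card_image)
  obtain ⟨p₀, hp₀, rfl⟩ := mem_image.1 hr
  refine le_trans (card_le_card_of_injOn (fun p => p.1 0) (fun p hp => ?_) ?_) (hK (u (p₀.1 0)))
  · obtain ⟨hpP, hpr⟩ := mem_filter.1 hp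
    obtain ⟨htail, hsnd⟩ := Prod.ext_iff.1 hpr
    refine mem_coe.2 (mem_filter.2 ⟨(mem_P p hpP).1 0, ?_⟩)
    have h := (mem_P p hpP).2.2
    rw [show p.2 = p₀.2 from hsnd, ← (mem_P p₀ hp₀).2.2,
      show Fin.tail p.1 = Fin.tail p₀.1 from htail] at h
    exact add_right_cancel h
  · intro p hp q hq (hpq : p.1 0 = q.1 0)
    obtain ⟨htail, hsnd⟩ :=
      Prod.ext_iff.1 ((mem_filter.1 hp).2.trans (mem_filter.1 hq).2.symm)
    refine Prod.ext ?_ hsnd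
    rw [← Fin.cons_self_tail p.1, ← Fin.cons_self_tail q.1, hpq]
    exact congrArg _ htail

end Collisions

section BilinearSums

open Finset

variable {A B R : Type*}

theorem sum_norm_sq_sum_fiber_le {G : Type*} [Fintype G] [DecidableEq G] (s : Finset A)
    (U : A → G) {θ : A → ℂ}
    (hθ : ∀ x ∈ s, ‖θ x‖ ≤ 1) :
    ∑ c, ‖∑ x ∈ s with U x = c, θ x‖ ^ 2 ≤ collisionCount s U := by
  rw [collisionCount_eq_sum_sq (t := univ) fun _ _ => by simp]
  push_cast
  gcongr with c
  simpa using norm_sum_le_of_le _ fun x hx => hθ x (mem_filter.1 hx).1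

theorem norm_prod_le_one_of_mem_piFinset {ι : Type*} [Fintype ι] [DecidableEq ι] {s : Finset A}
    {θ : A → ℂ} (hθ : ∀ x ∈ s, ‖θ x‖ ≤ 1) {p : ι → A} (hp : p ∈ Fintype.piFinset fun _ => s) :
    ‖∏ i, θ (p i)‖ ≤ 1 := by
  rw [norm_prod]
  exact prod_le_one (fun _ _ => norm_nonneg _) fun i _ => hθ _ (Fintype.mem_piFinset.1 hp i)

variable [CommRing R]

/-- The bilinear exponential sum `∑ α x β y ψ (u x v y)` over `x ∈ s` and `y ∈ t`. -/
noncomputable def bilinearSum (ψ : AddChar R ℂ) (s : Finset A) (t : Finset B) (u : A → R)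
    (v : B → R) (α : A → ℂ) (β : B → ℂ) : ℂ :=
  ∑ x ∈ s, ∑ y ∈ t, α x * β y * ψ (u x * v y)

theorem exists_norm_sum_mul_pow_le (s : Finset A) {α : A → ℂ} (hα : ∀ x ∈ s, ‖α x‖ ≤ 1)
    (F : A → ℂ) {k : ℕ} (hk : 1 ≤ k) :
    ∃ θ : A → ℂ, (∀ x, ‖θ x‖ ≤ 1) ∧
      ‖∑ x ∈ s, α x * F x‖ ^ k ≤ (#s : ℝ) ^ (k - 1) * ‖∑ x ∈ s, θ x * F x ^ k‖ := by
  obtain ⟨n, rfl⟩ := Nat.exists_eq_add_of_le' hk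
  choose θ norm_θ hθ using fun x => Complex.exists_norm_eq_mul_self (F x ^ (n + 1))
  have norm_sum_θ : ‖∑ x ∈ s, θ x * F x ^ (n + 1)‖ = ∑ x ∈ s, ‖F x‖ ^ (n + 1) := by
    simp_rw [← hθ, norm_pow, ← Complex.ofReal_sum]
    exact Complex.norm_of_nonneg (sum_nonneg fun _ _ => by positivity)
  refine ⟨θ, fun x => (norm_θ x).le, ?_⟩
  rw [norm_sum_θ, Nat.add_sub_cancel]
  calc ‖∑ x ∈ s, α x * F x‖ ^ (n + 1) ≤ (∑ x ∈ s, ‖F x‖) ^ (n + 1) := by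
        gcongr
        refine norm_sum_le_of_le s fun x hx => ?_
        rw [norm_mul]
        exact mul_le_of_le_one_left (norm_nonneg _) (hα x hx)
    _ ≤ (#s : ℝ) ^ n * ∑ x ∈ s, ‖F x‖ ^ (n + 1) :=
        pow_sum_le_card_mul_sum_pow (fun _ _ => norm_nonneg _) n

theorem sum_mul_addChar_pow (ψ : AddChar R ℂ) (t : Finset B) (β : B → ℂ) (v : B → R) (r : R)
    (k : ℕ) :
    (∑ y ∈ t, β y * ψ (r * v y)) ^ k =
      ∑ p ∈ Fintype.piFinset fun _ : Fin k => t, (∏ i, β (p i)) * ψ ((∑ i, v (p i)) * r) := by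
  rw [sum_pow']
  refine sum_congr rfl fun p _ => ?_
  rw [prod_mul_distrib, mul_comm _ r, mul_sum]
  congr 1
  exact (map_prod ψ.toMonoidHom (fun i => Multiplicative.ofAdd (r * v (p i))) univ).symm

theorem exists_norm_bilinearSum_pow_le (ψ : AddChar R ℂ) (s : Finset A) (t : Finset B)
    (u : A → R) (v : B → R) {α : A → ℂ} (hα : ∀ x ∈ s, ‖α x‖ ≤ 1) (β : B → ℂ) {k : ℕ}
    (hk : 1 ≤ k) :
    ∃ θ : A → ℂ, (∀ x, ‖θ x‖ ≤ 1) ∧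
      ‖bilinearSum ψ s t u v α β‖ ^ k ≤ (#s : ℝ) ^ (k - 1) *
        ‖bilinearSum ψ (Fintype.piFinset fun _ : Fin k => t) s (fun p => ∑ i, v (p i)) u
          (fun p => ∏ i, β (p i)) θ‖ := by
  obtain ⟨θ, hθ, hsum⟩ :=
    exists_norm_sum_mul_pow_le s hα (fun x => ∑ y ∈ t, β y * ψ (u x * v y)) hk
  refine ⟨θ, hθ, ?_⟩
  convert hsum using 3
  · simp only [bilinearSum, mul_sum, mul_assoc]
  · unfold bilinearSum
    rw [sum_comm]
    simp_rw [sum_mul_addChar_pow, mul_sum, mul_assoc, mul_left_comm (θ _)]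

variable [Fintype R] {ψ : AddChar R ℂ}

theorem sum_norm_sq_sum_mul_addChar (hψ : ψ.IsPrimitive) (g : R → ℂ) :
    ∑ c, ‖∑ d, g d * ψ (c * d)‖ ^ 2 = Fintype.card R * ∑ d, ‖g d‖ ^ 2 := by
  classical
  have expand (c : R) : ((‖∑ d, g d * ψ (c * d)‖ ^ 2 : ℝ) : ℂ) =
      ∑ d, ∑ e, g d * starRingEnd ℂ (g e) * ψ (c * (d - e)) := by
    rw [Complex.ofReal_pow, ← Complex.mul_conj', map_sum, sum_mul_sum]
    refine sum_congr rfl fun d _ => sum_congr rfl fun e _ => ?_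
    rw [_root_.map_mul (starRingEnd ℂ), ← AddChar.inv_apply_eq_conj, mul_sub,
      AddChar.map_sub_eq_div]
    ring
  have orthogonality (d e : R) :
      ∑ c, ψ (c * (d - e)) = if d = e then (Fintype.card R : ℂ) else 0 := by
    simp [AddChar.sum_mulShift _ hψ, sub_eq_zero]
  apply Complex.ofReal_injective
  rw [Complex.ofReal_sum, sum_congr rfl fun c _ => expand c, sum_comm]
  simp_rw [sum_comm (s := univ) (t := univ) (f := fun c _ => _ * ψ (c * _)), ← mul_sum,
    orthogonality]
  simp [mul_sum, Complex.mul_conj', mul_comm]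

theorem norm_sum_sum_mul_addChar_sq_le (hψ : ψ.IsPrimitive) (f g : R → ℂ) :
    ‖∑ c, ∑ d, f c * g d * ψ (c * d)‖ ^ 2 ≤
      Fintype.card R * (∑ c, ‖f c‖ ^ 2) * ∑ d, ‖g d‖ ^ 2 := by
  simp_rw [mul_assoc (f _), ← mul_sum]
  calc ‖∑ c, f c * ∑ d, g d * ψ (c * d)‖ ^ 2
      ≤ (∑ c, ‖f c‖ * ‖∑ d, g d * ψ (c * d)‖) ^ 2 := by
        gcongr
        exact norm_sum_le_of_le _ fun c _ => (norm_mul _ _).le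
    _ ≤ (∑ c, ‖f c‖ ^ 2) * ∑ c, ‖∑ d, g d * ψ (c * d)‖ ^ 2 := sum_mul_sq_le_sq_mul_sq _ _ _
    _ = Fintype.card R * (∑ c, ‖f c‖ ^ 2) * ∑ d, ‖g d‖ ^ 2 := by
        rw [sum_norm_sq_sum_mul_addChar hψ]
        ring

variable [DecidableEq R]

theorem bilinearSum_eq_sum_sum_fiber (s : Finset A) (t : Finset B) (U : A → R) (V : B → R)
    (θ : A → ℂ) (η : B → ℂ) :
    bilinearSum ψ s t U V θ η =
      ∑ c, ∑ d, (∑ x ∈ s with U x = c, θ x) * (∑ y ∈ t with V y = d, η y) * ψ (c * d) := by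
  rw [bilinearSum, ← sum_fiberwise s U]
  refine sum_congr rfl fun c _ => ?_
  simp_rw [← sum_fiberwise t V (fun y => _ * η y * ψ _)]
  rw [sum_comm]
  refine sum_congr rfl fun d _ => ?_
  rw [sum_mul_sum, sum_mul]
  refine sum_congr rfl fun x hx => ?_
  rw [sum_mul]
  refine sum_congr rfl fun y hy => ?_
  rw [(mem_filter.1 hx).2, (mem_filter.1 hy).2]

theorem norm_bilinearSum_sq_le (hψ : ψ.IsPrimitive) {s : Finset A} {t : Finset B} (U : A → R)
    (V : B → R) {θ : A → ℂ} {η : B → ℂ} (hθ : ∀ x ∈ s, ‖θ x‖ ≤ 1) (hη : ∀ y ∈ t, ‖η y‖ ≤ 1) :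
    ‖bilinearSum ψ s t U V θ η‖ ^ 2 ≤
      Fintype.card R * collisionCount s U * collisionCount t V := by
  rw [bilinearSum_eq_sum_sum_fiber]
  refine (norm_sum_sum_mul_addChar_sq_le hψ _ _).trans ?_
  gcongr
  · exact sum_norm_sq_sum_fiber_le s U hθ
  · exact sum_norm_sq_sum_fiber_le t V hη

-- Hölder in `x` replaces `y` by an `l`-tuple; Hölder in that tuple replaces `x` by a `k`-tuple.
theorem norm_bilinearSum_pow_le_sumEnergy (hψ : ψ.IsPrimitive) {s : Finset A} {t : Finset B}
    (u : A → R) (v : B → R) {α : A → ℂ} {β : B → ℂ} (hα : ∀ x ∈ s, ‖α x‖ ≤ 1)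
    (hβ : ∀ y ∈ t, ‖β y‖ ≤ 1) {k l : ℕ} (hk : 1 ≤ k) (hl : 1 ≤ l) :
    ‖bilinearSum ψ s t u v α β‖ ^ (2 * k * l) ≤
      (#s : ℝ) ^ (2 * k * (l - 1)) * (#t : ℝ) ^ (2 * l * (k - 1)) *
        (Fintype.card R * sumEnergy k s u * sumEnergy l t v) := by
  set S := Fintype.piFinset fun _ : Fin k => s
  set T := Fintype.piFinset fun _ : Fin l => t
  obtain ⟨θ, hθ, holder_fst⟩ := exists_norm_bilinearSum_pow_le ψ s t u v hα β hl
  obtain ⟨η, hη, holder_snd⟩ := exists_norm_bilinearSum_pow_le ψ T s (fun p => ∑ i, v (p i)) u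
    (fun p hp => norm_prod_le_one_of_mem_piFinset hβ hp) θ hk
  have cauchy := norm_bilinearSum_sq_le hψ (s := S) (t := T) (fun p => ∑ i, u (p i))
    (fun p => ∑ i, v (p i)) (fun p hp => norm_prod_le_one_of_mem_piFinset (fun x _ => hθ x) hp)
    (fun p _ => hη p)
  set X := ‖bilinearSum ψ s t u v α β‖
  set Y := ‖bilinearSum ψ T s _ _ _ _‖
  set Z := ‖bilinearSum ψ S T _ _ _ _‖
  have card_T : (#T : ℝ) = (#t : ℝ) ^ l := by simp [T]
  calc X ^ (2 * k * l) = ((X ^ l) ^ k) ^ 2 := by rw [← pow_mul, ← pow_mul]; ring_nf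
    _ ≤ (((#s : ℝ) ^ (l - 1) * Y) ^ k) ^ 2 := by gcongr
    _ = (((#s : ℝ) ^ (l - 1)) ^ k * Y ^ k) ^ 2 := by rw [mul_pow]
    _ ≤ (((#s : ℝ) ^ (l - 1)) ^ k * (((#t : ℝ) ^ l) ^ (k - 1) * Z)) ^ 2 := by
        rw [← card_T]
        gcongr
    _ = (#s : ℝ) ^ (2 * k * (l - 1)) * (#t : ℝ) ^ (2 * l * (k - 1)) * Z ^ 2 := by
        simp only [mul_pow, ← pow_mul]
        ring_nf
    _ ≤ _ := by
        gcongr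
        exact cauchy

end BilinearSums

section Slopes

open Finset

theorem card_le_of_pairwise_le_abs_sub {T : Finset ℝ} {δ L : ℝ} (hδ : 0 < δ) (hL : 0 ≤ L)
    (hT : ∀ x ∈ T, x ∈ Set.Icc 0 L) (hsep : (T : Set ℝ).Pairwise fun x y => δ ≤ |x - y|) :
    (#T : ℝ) ≤ L / δ + 1 := by
  have maps : Set.MapsTo (fun x => ⌊x / δ⌋₊) T (range (⌊L / δ⌋₊ + 1)) := fun x hx => by
    have : x ≤ L := (hT x hx).2
    exact mem_coe.2 (mem_range_succ_iff.2 (Nat.floor_le_floor (by gcongr)))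
  have inj : Set.InjOn (fun x => ⌊x / δ⌋₊) T := fun x hx y hy hxy => by
    by_contra hne
    refine (hsep hx hy hne).not_gt ?_
    have : |x / δ - y / δ| < 1 := by
      have nonneg (z) (hz : z ∈ T) : 0 ≤ z / δ := div_nonneg (hT z hz).1 hδ.le
      refine Int.abs_sub_lt_one_of_floor_eq_floor ?_
      rw [← Int.natCast_floor_eq_floor (nonneg x hx), ← Int.natCast_floor_eq_floor (nonneg y hy)]
      exact congrArg _ hxy
    rwa [← sub_div, abs_div, abs_of_pos hδ, div_lt_one hδ] at this
  calc (#T : ℝ) ≤ (⌊L / δ⌋₊ + 1 : ℕ) := by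
        exact_mod_cast (card_le_card_of_injOn _ maps inj).trans_eq (card_range _)
    _ ≤ L / δ + 1 := by
        push_cast
        gcongr
        exact Nat.floor_le (by positivity)

theorem div_sq_le_abs_div_sub_div {m a b c d : ℕ} {Y : ℝ} (hb : 0 < b) (hbY : b ≤ Y) (hd : 0 < d)
    (hdY : d ≤ Y) (hmod : a * d ≡ c * b [MOD m]) (hne : (a / b : ℝ) ≠ c / d) :
    m / Y ^ 2 ≤ |(a / b : ℝ) - c / d| := by
  have hb' : (0 : ℝ) < b := mod_cast hb
  have hd' : (0 : ℝ) < d := mod_cast hd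
  have le_num : (m : ℝ) ≤ |(a * d - b * c : ℝ)| := by
    have num_ne : (a * d - b * c : ℤ) ≠ 0 := fun h => hne <| by
      rw [div_eq_div_iff hb'.ne' hd'.ne']
      exact_mod_cast (sub_eq_zero.1 h).trans (mul_comm _ _)
    have dvd : (m : ℤ) ∣ |(a * d - b * c : ℤ)| := by
      rw [dvd_abs, mul_comm (b : ℤ)]
      exact_mod_cast hmod.symm.dvd
    exact_mod_cast Int.le_of_dvd (abs_pos.2 num_ne) dvd
  rw [div_sub_div _ _ hb'.ne' hd'.ne', abs_div, abs_of_pos (mul_pos hb' hd')]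
  gcongr
  rw [sq]
  exact mul_le_mul hbY hdY hd'.le (hb'.le.trans hbY)

variable {A : Type*} {T : Finset A} {a b : A → ℕ} {m : ℕ} {X Y : ℝ}

theorem card_image_div_le_of_div_le (hm : 0 < m) (hX : 0 < X) (hY : 0 < Y)
    (hb : ∀ x ∈ T, 0 < b x ∧ b x ≤ Y) (hab : ∀ x ∈ T, (a x / b x : ℝ) ≤ X / Y)
    (hmod : ∀ x ∈ T, ∀ y ∈ T, a x * b y ≡ a y * b x [MOD m]) :
    (#(T.image fun x => (a x / b x : ℝ)) : ℝ) ≤ X * Y / m + 1 := by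
  have hm' : (0 : ℝ) < m := mod_cast hm
  convert card_le_of_pairwise_le_abs_sub (T := T.image fun x => (a x / b x : ℝ))
    (div_pos hm' (sq_pos_of_pos hY)) (div_pos hX hY).le ?_ ?_ using 2
  · field_simp
  · exact forall_mem_image.2 fun x hx => ⟨by positivity, hab x hx⟩
  · rw [coe_image]
    rintro _ ⟨x, hx, rfl⟩ _ ⟨y, hy, rfl⟩ hne
    exact div_sq_le_abs_div_sub_div (hb x hx).1 (hb x hx).2 (hb y hy).1 (hb y hy).2
      (hmod x hx y hy) hne

-- Slopes exceeding `X / Y` are counted through their inverses.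
theorem card_image_div_le (hm : 0 < m) (hX : 0 < X) (hY : 0 < Y)
    (ha : ∀ x ∈ T, 0 < a x ∧ a x ≤ X) (hb : ∀ x ∈ T, 0 < b x ∧ b x ≤ Y)
    (hmod : ∀ x ∈ T, ∀ y ∈ T, a x * b y ≡ a y * b x [MOD m]) :
    (#(T.image fun x => (a x / b x : ℝ)) : ℝ) ≤ 2 * (X * Y / m + 1) := by
  classical
  set T₁ := {x ∈ T | (a x / b x : ℝ) ≤ X / Y}
  set T₂ := {x ∈ T | ¬(a x / b x : ℝ) ≤ X / Y}
  have mem₁ : ∀ x ∈ T₁, x ∈ T := fun x hx => (mem_filter.1 hx).1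
  have mem₂ : ∀ x ∈ T₂, x ∈ T := fun x hx => (mem_filter.1 hx).1
  have card₁ : (#(T₁.image fun x => (a x / b x : ℝ)) : ℝ) ≤ X * Y / m + 1 :=
    card_image_div_le_of_div_le hm hX hY (fun x hx => hb x (mem₁ x hx))
      (fun x hx => (mem_filter.1 hx).2)
      fun x hx y hy => hmod x (mem₁ x hx) y (mem₁ y hy)
  have card₂ : (#(T₂.image fun x => (b x / a x : ℝ)) : ℝ) ≤ Y * X / m + 1 :=
    card_image_div_le_of_div_le hm hY hX (fun x hx => ha x (mem₂ x hx))
      (fun x hx => by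
        rw [← inv_div X Y, ← inv_div (a x : ℝ)]
        exact inv_anti₀ (by positivity) (not_le.1 (mem_filter.1 hx).2).le)
      fun x hx y hy => by
        simpa only [mul_comm] using hmod y (mem₂ y hy) x (mem₂ x hx)
  have card_inv : #(T₂.image fun x => (a x / b x : ℝ)) = #(T₂.image fun x => (b x / a x : ℝ)) := by
    rw [← card_image_of_injective _ inv_injective, image_image]
    simp only [Function.comp_def, inv_div]
  have card_union : #(T.image fun x => (a x / b x : ℝ)) ≤
      #(T₁.image fun x => (a x / b x : ℝ)) + #(T₂.image fun x => (a x / b x : ℝ)) := by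
    rw [← filter_union_filter_not_eq (fun x => (a x / b x : ℝ) ≤ X / Y) T, image_union]
    exact card_union_le _ _
  calc (#(T.image fun x => (a x / b x : ℝ)) : ℝ)
      ≤ #(T₁.image fun x => (a x / b x : ℝ)) + #(T₂.image fun x => (a x / b x : ℝ)) :=
        mod_cast card_union
    _ ≤ (X * Y / m + 1) + (Y * X / m + 1) := add_le_add card₁ (card_inv ▸ card₂)
    _ = 2 * (X * Y / m + 1) := by ring

end Slopes

section ReciprocalSums

open Finset

variable {ι : Type*} [Fintype ι] [DecidableEq ι]

/-- The numerator of `∑ i, 1 / x i` over the common denominator `∏ i, x i`. -/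
def reciprocalNumerator {R : Type*} [CommSemiring R] (x : ι → R) : R :=
  ∑ i, ∏ j ∈ univ.erase i, x j

theorem map_reciprocalNumerator {R S : Type*} [CommSemiring R] [CommSemiring S] (f : R →+* S)
    {x : ι → R} {y : ι → S} (h : ∀ i, f (x i) * y i = 1) :
    f (reciprocalNumerator x) = f (∏ i, x i) * ∑ i, y i := by
  rw [reciprocalNumerator, map_sum, mul_sum]
  refine sum_congr rfl fun i _ => ?_
  rw [← mul_prod_erase univ x (mem_univ i), map_mul, mul_right_comm, h, one_mul]

theorem reciprocalNumerator_pos [Nonempty ι] {x : ι → ℕ} (hx : ∀ i, 0 < x i) :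
    0 < reciprocalNumerator x :=
  sum_pos (fun _ _ => prod_pos fun j _ => hx j) univ_nonempty

theorem reciprocalNumerator_le {x : ι → ℕ} {N : ℕ} (hx : ∀ i, x i ≤ N) :
    reciprocalNumerator x ≤ Fintype.card ι * N ^ (Fintype.card ι - 1) := by
  refine sum_le_card_nsmul _ _ _ fun i _ => ?_
  refine (prod_le_pow_card _ _ N fun j _ => hx j).trans_eq ?_
  rw [card_erase_of_mem (mem_univ i), card_univ]

theorem sum_inv_eq_reciprocalNumerator_div {x : ι → ℕ} (hx : ∀ i, 0 < x i) :
    ∑ i, (x i : ℝ)⁻¹ = (reciprocalNumerator x : ℕ) / (∏ i, x i : ℕ) := by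
  rw [eq_div_iff (Nat.cast_ne_zero.2 (prod_pos fun i _ => hx i).ne'), mul_comm]
  exact (map_reciprocalNumerator (Nat.castRingHom ℝ) fun i =>
    mul_inv_cancel₀ (Nat.cast_ne_zero.2 (hx i).ne')).symm

theorem reciprocalNumerator_mul_prod_modEq {m : ℕ} {x y : ι → ℕ} (hx : ∀ i, (x i).Coprime m)
    (hy : ∀ i, (y i).Coprime m) (h : ∑ i, (x i : ZMod m)⁻¹ = ∑ i, (y i : ZMod m)⁻¹) :
    reciprocalNumerator x * ∏ i, y i ≡ reciprocalNumerator y * ∏ i, x i [MOD m] := by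
  have numerator_eq {z : ι → ℕ} (hz : ∀ i, (z i).Coprime m) :
      ((reciprocalNumerator z : ℕ) : ZMod m) = (∏ i, z i : ℕ) * ∑ i, (z i : ZMod m)⁻¹ :=
    map_reciprocalNumerator (Nat.castRingHom (ZMod m)) fun i => ZMod.coe_mul_inv_eq_one _ (hz i)
  rw [← ZMod.natCast_eq_natCast_iff, Nat.cast_mul, Nat.cast_mul, numerator_eq hx,
    numerator_eq hy, h]
  ring

theorem mem_coprimeInterval {m N x : ℕ} :
    x ∈ coprimeInterval m N ↔ (1 ≤ x ∧ x ≤ N) ∧ x.Coprime m := by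
  simp only [coprimeInterval, mem_filter, mem_Icc]

/-- The number of solutions of `x₁^* + ⋯ + x_k^* ≡ y₁^* + ⋯ + y_k^* (mod m)` in integers of
`[1, N]` coprime to `m`, where `*` denotes inversion modulo `m`. -/
def reciprocalEnergy (m N k : ℕ) : ℕ :=
  sumEnergy k (coprimeInterval m N) fun x => (x : ZMod m)⁻¹

theorem reciprocalEnergy_le_mul_sumEnergy {m N k : ℕ} (hm : 0 < m) (hN : 0 < N) (hk : 0 < k) :
    (reciprocalEnergy m N k : ℝ) ≤
      2 * (k * (N : ℝ) ^ (2 * k - 1) / m + 1) *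
        sumEnergy k (coprimeInterval m N) fun x => (x : ℝ)⁻¹ := by
  have : Nonempty (Fin k) := ⟨⟨0, hk⟩⟩
  unfold reciprocalEnergy sumEnergy
  refine collisionCount_le_mul fun c _ => ?_
  set T := {p ∈ Fintype.piFinset fun _ : Fin k => coprimeInterval m N |
    ∑ i, (p i : ZMod m)⁻¹ = c}
  have mem_of_mem_T {p : Fin k → ℕ} (hp : p ∈ T) (i : Fin k) : p i ∈ coprimeInterval m N :=
    Fintype.mem_piFinset.1 (mem_filter.1 hp).1 i
  have one_le {p : Fin k → ℕ} (hp : p ∈ T) (i : Fin k) : 1 ≤ p i :=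
    (mem_coprimeInterval.1 (mem_of_mem_T hp i)).1.1
  have le_N {p : Fin k → ℕ} (hp : p ∈ T) (i : Fin k) : p i ≤ N :=
    (mem_coprimeInterval.1 (mem_of_mem_T hp i)).1.2
  rw [image_congr fun p hp => sum_inv_eq_reciprocalNumerator_div (one_le hp)]
  convert card_image_div_le hm (X := k * (N : ℝ) ^ (k - 1)) (Y := (N : ℝ) ^ k) (by positivity)
    (by positivity) (fun p hp => ⟨reciprocalNumerator_pos (one_le hp), ?_⟩)
    (fun p hp => ⟨prod_pos fun i _ => one_le hp i, ?_⟩) (fun p hp q hq => ?_) using 4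
  · rw [mul_assoc, ← pow_add]
    congr 2
    lia
  · exact_mod_cast (reciprocalNumerator_le (le_N hp)).trans_eq (by simp)
  · exact_mod_cast (prod_le_pow_card univ p N fun i _ => le_N hp i).trans_eq (by simp)
  · exact reciprocalNumerator_mul_prod_modEq
      (fun i => (mem_coprimeInterval.1 (mem_of_mem_T hp i)).2)
      (fun i => (mem_coprimeInterval.1 (mem_of_mem_T hq i)).2)
      ((mem_filter.1 hp).2.trans (mem_filter.1 hq).2.symm)

end ReciprocalSums

section Squarefull

open Finset

/-- An element divisible by the square of each of its prime divisors; `0` is allowed. -/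
def IsSquarefull {M : Type*} [CommMonoidWithZero M] (n : M) : Prop :=
  ∀ p : M, Prime p → p ∣ n → p ^ 2 ∣ n

theorem IsSquarefull.natAbs {z : ℤ} (h : IsSquarefull z) : IsSquarefull z.natAbs := by
  intro p hp hpz
  rw [← Int.natCast_dvd, Nat.cast_pow]
  exact h p (Nat.prime_iff_prime_int.1 hp.nat_prime) (Int.natCast_dvd.2 hpz)

theorem IsSquarefull.of_mul_prime_pow {n p e : ℕ} (hp : Prime p) (h : IsSquarefull (n * p ^ e))
    (hn : p ∣ n → p ^ 2 ∣ n) : IsSquarefull n := by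
  intro r hr hrn
  rcases eq_or_ne r p with rfl | hrp
  · exact hn hrn
  · have coprime : (r ^ 2).Coprime (p ^ e) :=
      Nat.Coprime.pow _ _ ((Nat.coprime_primes hr.nat_prime hp.nat_prime).2 hrp)
    exact coprime.dvd_of_dvd_mul_right (h r hr (hrn.mul_right _))

variable {ι : Type*} [Fintype ι]

theorem isSquarefull_prod_of_reciprocalNumerator_eq_zero [DecidableEq ι] {R : Type*} [CommRing R]
    {w : ι → R} (hw : reciprocalNumerator w = 0) : IsSquarefull (∏ i, w i) := by
  intro p hp hpw
  obtain ⟨i, -, hi⟩ := (hp.dvd_finsetProd_iff _).1 hpw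
  have dvd_other : p ∣ ∑ l ∈ univ.erase i, ∏ j ∈ univ.erase l, w j := dvd_sum fun l hl =>
    hi.trans (dvd_prod_of_mem w (mem_erase.2 ⟨(ne_of_mem_erase hl).symm, mem_univ i⟩))
  have dvd_main : p ∣ ∏ j ∈ univ.erase i, w j := by
    rw [reciprocalNumerator, ← add_sum_erase univ _ (mem_univ i)] at hw
    exact (dvd_add_left dvd_other).1 (hw ▸ dvd_zero p)
  rw [← mul_prod_erase univ w (mem_univ i), sq]
  exact mul_dvd_mul hi dvd_main

theorem prod_eq_prod_mul_pow_sum {x y e : ι → ℕ} {p : ℕ} (h : ∀ i, x i = y i * p ^ e i) :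
    ∏ i, x i = (∏ i, y i) * p ^ ∑ i, e i := by
  rw [prod_congr rfl fun i _ => h i, prod_mul_distrib, prod_pow_eq_pow_sum]

variable [DecidableEq ι]

theorem exists_eq_mul_pow_single {p : ℕ} (hp : Prime p) {x : ι → ℕ} (h : p ∣ ∏ i, x i) :
    ∃ (i : ι) (y : ι → ℕ), ∀ j, x j = y j * p ^ (Pi.single i 1 : ι → ℕ) j := by
  obtain ⟨i, -, a, ha⟩ := (hp.dvd_finsetProd_iff _).1 h
  refine ⟨i, Function.update x i a, fun j => ?_⟩
  rcases eq_or_ne j i with rfl | hj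
  · simp [ha, mul_comm]
  · simp [hj]

/-- The multiplicity with which each index occurs in a pair or a triple of indices. These are the
patterns in which a prime factor of a squarefull product is shared between the entries. -/
def pairTripleMult : (ι × ι) ⊕ (ι × ι × ι) → ι → ℕ
  | .inl (i, j) => Pi.single i 1 + Pi.single j 1
  | .inr (i, j, l) => Pi.single i 1 + Pi.single j 1 + Pi.single l 1

theorem sum_pairTripleMult_inl (q : ι × ι) : ∑ i, pairTripleMult (.inl q) i = 2 := by
  simp [pairTripleMult, sum_add_distrib]

theorem sum_pairTripleMult_inr (q : ι × ι × ι) : ∑ i, pairTripleMult (.inr q) i = 3 := by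
  simp [pairTripleMult, sum_add_distrib]

theorem sum_pairTripleMult_ne_zero (q : (ι × ι) ⊕ (ι × ι × ι)) :
    ∑ i, pairTripleMult q i ≠ 0 := by
  rcases q with q | q
  · simp [sum_pairTripleMult_inl]
  · simp [sum_pairTripleMult_inr]

-- Remove two factors `p`, and a third one if exactly one factor `p` would be left over.
theorem IsSquarefull.exists_eq_mul_pow_pairTripleMult {p : ℕ} (hp : Prime p) {x : ι → ℕ}
    (hx : IsSquarefull (∏ i, x i)) (hpx : p ∣ ∏ i, x i) :
    ∃ (q : (ι × ι) ⊕ (ι × ι × ι)) (y : ι → ℕ),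
      (∀ i, x i = y i * p ^ pairTripleMult q i) ∧ IsSquarefull (∏ i, y i) := by
  obtain ⟨i, y, hy⟩ := exists_eq_mul_pow_single hp hpx
  have dvd_y : p ∣ ∏ r, y r := by
    have := hx p hp hpx
    rw [prod_eq_prod_mul_pow_sum hy, sum_pi_single', if_pos (mem_univ i), pow_one, sq] at this
    exact Nat.dvd_of_mul_dvd_mul_right hp.nat_prime.pos this
  obtain ⟨j, z, hz⟩ := exists_eq_mul_pow_single hp dvd_y
  have hxz (r : ι) : x r = z r * p ^ pairTripleMult (.inl (i, j)) r := by
    rw [hy, hz, mul_assoc, ← pow_add, add_comm]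
    rfl
  by_cases hpz : p ∣ ∏ r, z r → p ^ 2 ∣ ∏ r, z r
  · exact ⟨_, z, hxz, .of_mul_prime_pow hp (prod_eq_prod_mul_pow_sum hxz ▸ hx) hpz⟩
  obtain ⟨dvd_z, not_sq_dvd_z⟩ := Classical.not_imp.1 hpz
  obtain ⟨l, w, hw⟩ := exists_eq_mul_pow_single hp dvd_z
  have hxw (r : ι) : x r = w r * p ^ pairTripleMult (.inr (i, j, l)) r := by
    rw [hxz, hw, mul_assoc, ← pow_add, add_comm]
    rfl
  refine ⟨_, w, hxw, .of_mul_prime_pow hp (prod_eq_prod_mul_pow_sum hxw ▸ hx) fun dvd_w => ?_⟩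
  refine absurd ?_ not_sq_dvd_z
  rw [prod_eq_prod_mul_pow_sum hw, sum_pi_single', if_pos (mem_univ l), pow_one, sq]
  exact Nat.mul_dvd_mul_right dvd_w p

theorem IsSquarefull.exists_eq_prod_pow_pairTripleMult {x : ι → ℕ} (hx : ∏ i, x i ≠ 0)
    (hsq : IsSquarefull (∏ i, x i)) :
    ∃ d : (ι × ι) ⊕ (ι × ι × ι) → ℕ, ∀ i, x i = ∏ q, d q ^ pairTripleMult q i := by
  induction hn : ∏ i, x i using Nat.strong_induction_on generalizing x with
  | _ n ih =>
  rcases eq_or_ne n 1 with rfl | hn_one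
  · refine ⟨1, fun i => ?_⟩
    simpa using Nat.dvd_one.1 (hn ▸ dvd_prod_of_mem x (mem_univ i))
  obtain ⟨p, hp, hpn⟩ := Nat.exists_prime_and_dvd hn_one
  obtain ⟨q₀, y, hxy, hy⟩ := hsq.exists_eq_mul_pow_pairTripleMult hp.prime (hn ▸ hpn)
  have prod_x : n = (∏ i, y i) * p ^ ∑ i, pairTripleMult q₀ i :=
    hn ▸ prod_eq_prod_mul_pow_sum hxy
  have prod_y_ne : ∏ i, y i ≠ 0 := left_ne_zero_of_mul (prod_x ▸ hn ▸ hx)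
  have prod_y_lt : ∏ i, y i < n := by
    rw [prod_x]
    exact lt_mul_of_one_lt_right (Nat.pos_of_ne_zero prod_y_ne)
      (Nat.one_lt_pow (sum_pairTripleMult_ne_zero q₀) hp.one_lt)
  obtain ⟨d, hd⟩ := ih _ prod_y_lt prod_y_ne hy rfl
  refine ⟨fun q => d q * if q = q₀ then p else 1, fun i => ?_⟩
  simp_rw [mul_pow, prod_mul_distrib, ite_pow, one_pow]
  rw [prod_ite_eq' univ q₀, if_pos (mem_univ q₀), ← hd, hxy]

end Squarefull

section Rankin

open Finset

variable {ι κ : Type*} [Fintype ι] [Fintype κ]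

theorem prod_inv_sqrt_pow_sum {d : κ → ℕ} {e : κ → ι → ℕ} {x : ι → ℕ}
    (h : ∀ i, x i = ∏ q, d q ^ e q i) :
    ∏ q, (√(d q : ℝ))⁻¹ ^ ∑ i, e q i = ∏ i, (√(x i : ℝ))⁻¹ := by
  simp_rw [← prod_pow_eq_pow_sum]
  rw [prod_comm]
  refine prod_congr rfl fun i _ => ?_
  rw [h i, Nat.cast_prod, Real.sqrt_prod _ fun _ _ => by positivity, ← prod_inv_distrib]
  refine prod_congr rfl fun q _ => ?_
  have sqrt_pow : √((d q ^ e q i : ℕ) : ℝ) = √(d q : ℝ) ^ e q i := by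
    rw [Real.sqrt_eq_iff_eq_sq (by positivity) (by positivity), ← pow_mul, mul_comm, pow_mul,
      Real.sq_sqrt (by positivity), Nat.cast_pow]
  rw [sqrt_pow, inv_pow]

theorem mem_Icc_of_eq_prod_pow {N : ℕ} {d : κ → ℕ} {e : κ → ι → ℕ} {x : ι → ℕ}
    (h : ∀ i, x i = ∏ q, d q ^ e q i) (hx : ∀ i, x i ∈ Icc 1 N) {q : κ} (hq : ∑ i, e q i ≠ 0) :
    d q ∈ Icc 1 N := by
  obtain ⟨i, -, hi⟩ := exists_ne_zero_of_sum_ne_zero hq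
  have dvd : d q ∣ x i := by
    rw [h i]
    exact (dvd_pow_self _ hi).trans (dvd_prod_of_mem (fun q => d q ^ e q i) (mem_univ q))
  obtain ⟨one_le, le_N⟩ := mem_Icc.1 (hx i)
  exact mem_Icc.2 ⟨Nat.pos_of_dvd_of_pos dvd one_le, (Nat.le_of_dvd one_le dvd).trans le_N⟩

-- Rankin's trick: each tuple is counted with weight `∏ i, √(N / x i) ≥ 1`.
theorem card_le_of_eq_prod_pow {N : ℕ} {e : κ → ι → ℕ} (he : ∀ q, ∑ i, e q i ≠ 0)
    {S : Finset (ι → ℕ)} (hS : ∀ x ∈ S, ∀ i, x i ∈ Icc 1 N)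
    (h : ∀ x ∈ S, ∃ d : κ → ℕ, ∀ i, x i = ∏ q, d q ^ e q i) :
    (#S : ℝ) ≤ √N ^ Fintype.card ι * ∏ q, ∑ n ∈ Icc 1 N, (√(n : ℝ))⁻¹ ^ ∑ i, e q i := by
  classical
  choose! D hD using h
  let weight (d : κ → ℕ) : ℝ := ∏ q, (√(d q : ℝ))⁻¹ ^ ∑ i, e q i
  have inj : Set.InjOn D S := by
    intro x hx y hy hxy
    ext i
    rw [hD x hx i, hD y hy i, hxy]
  have one_le_weight : ∀ x ∈ S, 1 ≤ √N ^ Fintype.card ι * weight (D x) := by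
    intro x hx
    simp only [weight]
    rw [prod_inv_sqrt_pow_sum (hD x hx), ← card_univ, ← prod_const, ← prod_mul_distrib]
    refine one_le_prod fun i _ => ?_
    obtain ⟨one_le, le_N⟩ := mem_Icc.1 (hS x hx i)
    rw [← div_eq_mul_inv, one_le_div (Real.sqrt_pos.2 (by exact_mod_cast one_le))]
    exact Real.sqrt_le_sqrt (by exact_mod_cast le_N)
  calc (#S : ℝ) = ∑ _ ∈ S, (1 : ℝ) := by simp
    _ ≤ ∑ x ∈ S, √N ^ Fintype.card ι * weight (D x) := sum_le_sum one_le_weight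
    _ = √N ^ Fintype.card ι * ∑ d ∈ S.image D, weight d := by
        rw [sum_image inj, mul_sum]
    _ ≤ √N ^ Fintype.card ι * ∑ d ∈ Fintype.piFinset fun _ => Icc 1 N, weight d := by
        gcongr
        exact image_subset_iff.2 fun x hx =>
          Fintype.mem_piFinset.2 fun q => mem_Icc_of_eq_prod_pow (hD x hx) (hS x hx) (he q)
    _ = √N ^ Fintype.card ι * ∏ q, ∑ n ∈ Icc 1 N, (√(n : ℝ))⁻¹ ^ ∑ i, e q i := by
        rw [prod_univ_sum]

theorem inv_pow_three_le_two_mul_inv_sub_inv {a b : ℝ} (ha : 0 < a) (hab : a ≤ b)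
    (h : b ^ 2 = a ^ 2 + 1) : b⁻¹ ^ 3 ≤ 2 * (a⁻¹ - b⁻¹) := by
  have hb : 0 < b := ha.trans_le hab
  calc b⁻¹ ^ 3 = 2 / (b * b * (b + b)) := by field_simp; norm_num
    _ ≤ 2 / (a * b * (a + b)) := by gcongr
    _ = 2 * (a⁻¹ - b⁻¹) := by
        rw [inv_sub_inv ha.ne' hb.ne', eq_comm, mul_div_assoc', div_eq_div_iff (by positivity)
          (by positivity)]
        linear_combination 2 * a * b * h

theorem sum_inv_sqrt_pow_three_le (N : ℕ) : ∑ n ∈ Icc 1 N, (√(n : ℝ))⁻¹ ^ 3 ≤ 3 := by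
  rcases N.eq_zero_or_pos with rfl | hN
  · simp
  suffices ∑ n ∈ Icc 1 N, (√(n : ℝ))⁻¹ ^ 3 ≤ 3 - 2 * (√(N : ℝ))⁻¹ from
    this.trans (sub_le_self _ (by positivity))
  induction N, hN using Nat.le_induction with
  | base => norm_num
  | succ n hn ih =>
    rw [sum_Icc_succ_top (by lia)]
    have step := inv_pow_three_le_two_mul_inv_sub_inv (a := √(n : ℝ)) (b := √((n + 1 : ℕ) : ℝ))
      (Real.sqrt_pos.2 (by exact_mod_cast hn)) (Real.sqrt_le_sqrt (by simp)) (by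
        rw [Real.sq_sqrt (by positivity), Real.sq_sqrt (by positivity), Nat.cast_succ])
    linarith

theorem sum_inv_sqrt_sq_le (N : ℕ) : ∑ n ∈ Icc 1 N, (√(n : ℝ))⁻¹ ^ 2 ≤ 1 + Real.log N := by
  simp_rw [inv_pow, Real.sq_sqrt (Nat.cast_nonneg _)]
  refine le_of_eq_of_le ?_ (harmonic_le_one_add_log N)
  rw [harmonic_eq_sum_Icc]
  push_cast
  rfl

theorem card_le_of_isSquarefull_prod {N : ℕ} {S : Finset (ι → ℕ)}
    (hS : ∀ x ∈ S, ∀ i, x i ∈ Icc 1 N) (hsq : ∀ x ∈ S, IsSquarefull (∏ i, x i)) :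
    (#S : ℝ) ≤ √N ^ Fintype.card ι *
      ((1 + Real.log N) ^ Fintype.card ι ^ 2 * 3 ^ Fintype.card ι ^ 3) := by
  classical
  refine (card_le_of_eq_prod_pow sum_pairTripleMult_ne_zero hS fun x hx =>
    (hsq x hx).exists_eq_prod_pow_pairTripleMult
      (prod_pos fun i _ => (mem_Icc.1 (hS x hx i)).1).ne').trans ?_
  simp_rw [Fintype.prod_sum_type, sum_pairTripleMult_inl, sum_pairTripleMult_inr, prod_const,
    card_univ, Fintype.card_prod, ← sq, ← pow_succ']
  gcongr
  · exact sum_inv_sqrt_sq_le N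
  · exact sum_inv_sqrt_pow_three_le N

theorem isSquarefull_prod_mul_prod_of_sum_inv_eq {x y : ι → ℕ} (hx : ∀ i, 0 < x i)
    (hy : ∀ i, 0 < y i) (h : ∑ i, (x i : ℝ)⁻¹ = ∑ i, (y i : ℝ)⁻¹) :
    IsSquarefull ((∏ i, x i) * ∏ i, y i) := by
  classical
  let w : ι ⊕ ι → ℤ := Sum.elim (fun i => x i) fun i => -y i
  have w_ne_zero : ∀ i, w i ≠ 0 := by
    rintro (i | i)
    · simpa [w] using (hx i).ne'
    · simpa [w] using (hy i).ne'
  have numerator_eq_zero : reciprocalNumerator w = 0 := by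
    have := map_reciprocalNumerator (Int.castRingHom ℝ) (x := w) (y := fun i => (w i : ℝ)⁻¹)
      fun i => mul_inv_cancel₀ (Int.cast_ne_zero.2 (w_ne_zero i))
    have sum_eq_zero : ∑ i, (w i : ℝ)⁻¹ = 0 := by
      simp [w, Fintype.sum_sum_type, h, inv_neg]
    rw [sum_eq_zero, mul_zero, eq_intCast] at this
    exact Int.cast_eq_zero.1 this
  have natAbs_prod : (∏ i, w i).natAbs = (∏ i, x i) * ∏ i, y i :=
    (map_prod Int.natAbsHom w univ).trans (by simp [w, Fintype.prod_sum_type])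
  exact natAbs_prod ▸ (isSquarefull_prod_of_reciprocalNumerator_eq_zero numerator_eq_zero).natAbs

theorem sumEnergy_inv_real_le {N : ℕ} {s : Finset ℕ} (hs : s ⊆ Icc 1 N) (k : ℕ) :
    (sumEnergy k s fun x => (x : ℝ)⁻¹ : ℝ) ≤
      (N : ℝ) ^ k * ((1 + Real.log N) ^ (4 * k ^ 2) * 3 ^ (8 * k ^ 3)) := by
  unfold sumEnergy collisionCount
  set S := Fintype.piFinset fun _ : Fin k => s with hS
  set P := {p ∈ S ×ˢ S | ∑ i, (p.1 i : ℝ)⁻¹ = ∑ i, (p.2 i : ℝ)⁻¹} with hP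
  have mem_P : ∀ p ∈ P, (∀ i, p.1 i ∈ Icc 1 N) ∧ (∀ i, p.2 i ∈ Icc 1 N) ∧
      ∑ i, (p.1 i : ℝ)⁻¹ = ∑ i, (p.2 i : ℝ)⁻¹ := fun p hp => by
    simp only [hP, hS, mem_filter, mem_product, Fintype.mem_piFinset] at hp
    exact ⟨fun i => hs (hp.1.1 i), fun i => hs (hp.1.2 i), hp.2⟩
  let join (p : (Fin k → ℕ) × (Fin k → ℕ)) : Fin k ⊕ Fin k → ℕ := Sum.elim p.1 p.2
  have join_injective : Function.Injective join := (Equiv.sumArrowEquivProdArrow ..).symm.injective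
  have card_image_le := card_le_of_isSquarefull_prod (N := N) (S := P.image join)
    (forall_mem_image.2 fun p hp => Sum.forall.2 ⟨(mem_P p hp).1, (mem_P p hp).2.1⟩)
    (forall_mem_image.2 fun p hp => by
      simpa [join] using isSquarefull_prod_mul_prod_of_sum_inv_eq
        (fun i => (mem_Icc.1 ((mem_P p hp).1 i)).1) (fun i => (mem_Icc.1 ((mem_P p hp).2.1 i)).1)
        (mem_P p hp).2.2)
  rw [card_image_of_injective P join_injective, Fintype.card_sum, Fintype.card_fin, ← two_mul,
    pow_mul √(N : ℝ), Real.sq_sqrt (Nat.cast_nonneg N)] at card_image_le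
  convert card_image_le using 4 <;> ring

end Rankin

section ReciprocalEnergy

open Finset

theorem card_coprimeInterval_le (m N : ℕ) : #(coprimeInterval m N) ≤ N :=
  (card_filter_le _ _).trans_eq (by simp)

theorem card_coprimeInterval_inv_eq_le (m N : ℕ) (c : ZMod m) :
    #{x ∈ coprimeInterval m N | ((x : ℕ) : ZMod m)⁻¹ = c} ≤ N / m + 1 := by
  rw [← card_range (N / m + 1)]
  refine card_le_card_of_injOn (fun x : ℕ => x / m) (fun x hx => ?_) fun x hx y hy hxy => ?_
  · have le_N := (mem_coprimeInterval.1 (mem_filter.1 hx).1).1.2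
    exact mem_coe.2 (mem_range_succ_iff.2 (Nat.div_le_div_right le_N))
  · obtain ⟨hxs, hxc⟩ := mem_filter.1 hx
    obtain ⟨hys, hyc⟩ := mem_filter.1 hy
    have x_mul_c := hxc ▸ ZMod.coe_mul_inv_eq_one x (mem_coprimeInterval.1 hxs).2
    have y_mul_c := hyc ▸ ZMod.coe_mul_inv_eq_one y (mem_coprimeInterval.1 hys).2
    have cast_eq : (x : ZMod m) = y := by
      linear_combination (y : ZMod m) * x_mul_c - (x : ZMod m) * y_mul_c
    have mod_eq : x % m = y % m := (ZMod.natCast_eq_natCast_iff x y m).1 cast_eq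
    rw [← Nat.div_add_mod x m, ← Nat.div_add_mod y m, mod_eq, show x / m = y / m from hxy]

theorem reciprocalEnergy_le_mul_pow (m N : ℕ) {k : ℕ} (hk : 0 < k) :
    reciprocalEnergy m N k ≤ (N / m + 1) * N ^ (2 * k - 1) := by
  obtain ⟨n, rfl⟩ := Nat.exists_eq_succ_of_ne_zero hk.ne'
  refine (sumEnergy_succ_le (card_coprimeInterval_inv_eq_le m N) n).trans ?_
  rw [show 2 * (n + 1) - 1 = 2 * n + 1 by lia]
  gcongr
  exact card_coprimeInterval_le m N

theorem half_le_log {x : ℝ} (hx : 2 ≤ x) : 1 / 2 ≤ Real.log x := by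
  have := Real.log_two_gt_d9
  linarith [Real.log_le_log two_pos hx]

variable {m N k : ℕ}

theorem reciprocalEnergy_le_of_lt (hm : 2 ≤ m) (hN : 0 < N) (hk : 0 < k) (hNm : N < m) :
    (reciprocalEnergy m N k : ℝ) ≤ (2 * k) ^ (16 * k ^ 3 + 8 * k ^ 2 + 1) *
      Real.log m ^ (4 * k ^ 2) * (((N : ℝ) ^ (2 * k - 1) / m + 1) * (N : ℝ) ^ k) := by
  have one_le_k : (1 : ℝ) ≤ k := mod_cast hk
  have one_le_N : (1 : ℝ) ≤ N := mod_cast hN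
  have half_le := half_le_log (x := m) (mod_cast hm)
  have log_N_le : Real.log N ≤ Real.log m := Real.log_le_log (by positivity) (mod_cast hNm.le)
  have := Real.log_nonneg one_le_N
  set L := Real.log m
  set E := (N : ℝ) ^ (2 * k - 1) / m
  have : 0 ≤ E := by positivity
  calc (reciprocalEnergy m N k : ℝ)
      ≤ 2 * (k * (N : ℝ) ^ (2 * k - 1) / m + 1) *
          sumEnergy k (coprimeInterval m N) fun x => (x : ℝ)⁻¹ :=
        reciprocalEnergy_le_mul_sumEnergy (by lia) hN hk
    _ ≤ 2 * (k * E + k) * ((N : ℝ) ^ k * ((4 * L) ^ (4 * k ^ 2) * 4 ^ (8 * k ^ 3))) := by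
        rw [mul_div_assoc]
        gcongr
        refine (sumEnergy_inv_real_le (filter_subset _ _) k).trans ?_
        gcongr
        · linarith
        · norm_num
    _ = 2 * k * 2 ^ (16 * k ^ 3 + 8 * k ^ 2) * L ^ (4 * k ^ 2) * ((E + 1) * (N : ℝ) ^ k) := by
        rw [mul_pow, show (4 : ℝ) = 2 ^ 2 by norm_num, ← pow_mul, ← pow_mul, pow_add]
        ring_nf
    _ ≤ 2 * k * (2 * k) ^ (16 * k ^ 3 + 8 * k ^ 2) * L ^ (4 * k ^ 2) *
          ((E + 1) * (N : ℝ) ^ k) := by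
        gcongr
        linarith
    _ = _ := by rw [pow_succ' (2 * (k : ℝ))]

theorem reciprocalEnergy_le_of_le (hm : 2 ≤ m) (hk : 0 < k) (hmN : m ≤ N) :
    (reciprocalEnergy m N k : ℝ) ≤ (2 * k) ^ (4 * k ^ 2 + 1) * Real.log m ^ (4 * k ^ 2) *
      (((N : ℝ) ^ (2 * k - 1) / m + 1) * (N : ℝ) ^ k) := by
  have one_le_k : (1 : ℝ) ≤ k := mod_cast hk
  have one_le_N : (1 : ℝ) ≤ N := mod_cast (by lia : 1 ≤ N)
  have half_le := half_le_log (x := m) (mod_cast hm)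
  have one_le_div : 1 ≤ (N / m : ℝ) := by
    rw [one_le_div (by positivity)]
    exact_mod_cast hmN
  set L := Real.log m
  set E := (N : ℝ) ^ (2 * k - 1) / m with hE
  calc (reciprocalEnergy m N k : ℝ) ≤ ((N / m : ℕ) + 1) * (N : ℝ) ^ (2 * k - 1) :=
        mod_cast reciprocalEnergy_le_mul_pow m N hk
    _ ≤ (N / m + N / m) * (N : ℝ) ^ (2 * k - 1) := by
        gcongr
        exact Nat.cast_div_le
    _ = 2 * 1 * (E * N) := by
        rw [hE]
        ring
    _ ≤ 2 * (2 * L) ^ (4 * k ^ 2) * ((E + 1) * (N : ℝ) ^ k) := by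
        gcongr
        · exact one_le_pow₀ (by linarith)
        · linarith
        · exact le_self_pow₀ one_le_N hk.ne'
    _ = 2 ^ (4 * k ^ 2 + 1) * L ^ (4 * k ^ 2) * ((E + 1) * (N : ℝ) ^ k) := by
        rw [mul_pow, pow_succ]
        ring
    _ ≤ (2 * k) ^ (4 * k ^ 2 + 1) * L ^ (4 * k ^ 2) * ((E + 1) * (N : ℝ) ^ k) := by
        gcongr
        linarith

theorem reciprocalEnergy_lt (hm : 2 ≤ m) (hN : 0 < N) (hk : 0 < k) :
    (reciprocalEnergy m N k : ℝ) < (2 * k) ^ (90 * k ^ 3) * Real.log m ^ (4 * k ^ 2) *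
      (((N : ℝ) ^ (2 * k - 1) / m + 1) * (N : ℝ) ^ k) := by
  have one_lt : (1 : ℝ) < 2 * k := mod_cast (by lia : 1 < 2 * k)
  have log_pos : 0 < Real.log m := Real.log_pos (mod_cast hm)
  have sq_le_cube : k ^ 2 ≤ k ^ 3 := Nat.pow_le_pow_right hk (by simp)
  have one_le_sq : 1 ≤ k ^ 2 := Nat.one_le_pow _ _ hk
  rcases lt_or_ge N m with hNm | hmN
  · refine (reciprocalEnergy_le_of_lt hm hN hk hNm).trans_lt ?_
    gcongr
    lia
  · refine (reciprocalEnergy_le_of_le hm hk hmN).trans_lt ?_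
    gcongr
    lia

end ReciprocalEnergy

section BilinearKloosterman

theorem eMod_mul_invMod_mul_invMod (m : ℕ) [NeZero m] (a : ℤ) (x y : ℕ) :
    eMod m (a * (invMod m x : ℤ) * (invMod m y : ℤ)) =
      ZMod.stdAddChar (((a : ZMod m) * (x : ZMod m)⁻¹) * (y : ZMod m)⁻¹) := by
  rw [eMod, ← ZMod.stdAddChar_coe]
  simp [invMod]

theorem bilinearKloosterman_eq_bilinearSum (m : ℕ) [NeZero m] (a : ℤ) (N₁ N₂ : ℕ)
    (α₁ α₂ : ℕ → ℂ) :
    bilinearKloosterman m a N₁ N₂ α₁ α₂ =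
      bilinearSum (ZMod.stdAddChar (N := m)) (coprimeInterval m N₁) (coprimeInterval m N₂)
        (fun x => (a : ZMod m) * (x : ZMod m)⁻¹) (fun y => (y : ZMod m)⁻¹) α₁ α₂ := by
  simp_rw [bilinearKloosterman, eMod_mul_invMod_mul_invMod, bilinearSum]

variable {m N₁ N₂ k₁ k₂ : ℕ} {a : ℤ} {α₁ α₂ : ℕ → ℂ}

theorem norm_bilinearKloosterman_pow_le (hm : m ≠ 0) (ha : IsCoprime a (m : ℤ)) (hk₁ : 1 ≤ k₁)
    (hk₂ : 1 ≤ k₂) (hα₁ : ∀ x ∈ Finset.Icc 1 N₁, ‖α₁ x‖ ≤ 1)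
    (hα₂ : ∀ x ∈ Finset.Icc 1 N₂, ‖α₂ x‖ ≤ 1) :
    ‖bilinearKloosterman m a N₁ N₂ α₁ α₂‖ ^ (2 * k₁ * k₂) ≤
      (N₁ : ℝ) ^ (2 * k₁ * (k₂ - 1)) * (N₂ : ℝ) ^ (2 * k₂ * (k₁ - 1)) *
        (m * reciprocalEnergy m N₁ k₁ * reciprocalEnergy m N₂ k₂) := by
  have : NeZero m := ⟨hm⟩
  have a_unit : IsUnit (a : ZMod m) := (ZMod.coe_int_isUnit_iff_isCoprime a m).2 ha.symm
  have energy_bound := norm_bilinearSum_pow_le_sumEnergy (ZMod.isPrimitive_stdAddChar m)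
    (s := coprimeInterval m N₁) (t := coprimeInterval m N₂)
    (fun x => (a : ZMod m) * (x : ZMod m)⁻¹) (fun y => (y : ZMod m)⁻¹)
    (fun x hx => hα₁ x (Finset.mem_filter.1 hx).1) (fun x hx => hα₂ x (Finset.mem_filter.1 hx).1)
    hk₁ hk₂
  rw [← bilinearKloosterman_eq_bilinearSum, sumEnergy_isUnit_mul a_unit, ZMod.card] at energy_bound
  refine energy_bound.trans ?_
  unfold reciprocalEnergy
  gcongr
  · exact card_coprimeInterval_le m N₁
  · exact card_coprimeInterval_le m N₂

theorem sqrt_mul_pow_mul_energy_factor {M N : ℝ} {k l : ℕ} (hM : 0 < M) (hN : 0 < N) (hk : 1 ≤ k)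
    (hl : 1 ≤ l) :
    √M * (N ^ (2 * k * (l - 1)) * ((N ^ (2 * k - 1) / M + 1) * N ^ k)) =
      (N ^ (k - 1) / √M + √M / N ^ k) * N ^ (2 * k * l) := by
  obtain ⟨i, rfl⟩ := Nat.exists_eq_add_of_le' hk
  obtain ⟨j, rfl⟩ := Nat.exists_eq_add_of_le' hl
  have sqrt_pos : 0 < √M := Real.sqrt_pos.2 hM
  have M_eq : M = √M ^ 2 := (Real.sq_sqrt hM.le).symm
  set r := √M
  rw [M_eq, show 2 * (i + 1) - 1 = 2 * i + 1 by lia, Nat.add_sub_cancel, Nat.add_sub_cancel,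
    show 2 * (i + 1) * (j + 1) = 2 * (i + 1) * j + (i + 1) + (i + 1) by ring]
  field_simp
  ring

theorem norm_bilinearKloosterman_pow_lt (hm : 2 ≤ m) (ha : IsCoprime a (m : ℤ)) (hN₁ : 1 ≤ N₁)
    (hN₂ : 1 ≤ N₂) (hk₁ : 1 ≤ k₁) (hk₂ : 1 ≤ k₂) (hα₁ : ∀ x ∈ Finset.Icc 1 N₁, ‖α₁ x‖ ≤ 1)
    (hα₂ : ∀ x ∈ Finset.Icc 1 N₂, ‖α₂ x‖ ≤ 1) :
    ‖bilinearKloosterman m a N₁ N₂ α₁ α₂‖ ^ (2 * k₁ * k₂) <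
      (2 * (k₁ : ℝ)) ^ (90 * k₁ ^ 3) * (2 * (k₂ : ℝ)) ^ (90 * k₂ ^ 3) *
        Real.log m ^ (4 * k₁ ^ 2 + 4 * k₂ ^ 2) *
        ((N₁ : ℝ) ^ (k₁ - 1) / √m + √m / (N₁ : ℝ) ^ k₁) *
        ((N₂ : ℝ) ^ (k₂ - 1) / √m + √m / (N₂ : ℝ) ^ k₂) *
        ((N₁ : ℝ) * N₂) ^ (2 * k₁ * k₂) := by
  have m_pos : (0 : ℝ) < m := mod_cast (by lia : 0 < m)
  have N₁_pos : (0 : ℝ) < N₁ := mod_cast hN₁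
  have N₂_pos : (0 : ℝ) < N₂ := mod_cast hN₂
  have factor₁ := sqrt_mul_pow_mul_energy_factor m_pos N₁_pos hk₁ hk₂
  have factor₂ := sqrt_mul_pow_mul_energy_factor m_pos N₂_pos hk₂ hk₁
  have energies_lt := mul_lt_mul'' (reciprocalEnergy_lt hm hN₁ hk₁)
    (reciprocalEnergy_lt hm hN₂ hk₂) (Nat.cast_nonneg _) (Nat.cast_nonneg _)
  refine (norm_bilinearKloosterman_pow_le (by lia) ha hk₁ hk₂ hα₁ hα₂).trans_lt ?_
  set G₁ := ((N₁ : ℝ) ^ (2 * k₁ - 1) / m + 1) * (N₁ : ℝ) ^ k₁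
  set G₂ := ((N₂ : ℝ) ^ (2 * k₂ - 1) / m + 1) * (N₂ : ℝ) ^ k₂
  calc _ < (N₁ : ℝ) ^ (2 * k₁ * (k₂ - 1)) * (N₂ : ℝ) ^ (2 * k₂ * (k₁ - 1)) *
        (m * (((2 * (k₁ : ℝ)) ^ (90 * k₁ ^ 3) * Real.log m ^ (4 * k₁ ^ 2) * G₁) *
          ((2 * (k₂ : ℝ)) ^ (90 * k₂ ^ 3) * Real.log m ^ (4 * k₂ ^ 2) * G₂))) := by
        rw [mul_assoc (m : ℝ)]
        gcongr
    _ = (2 * (k₁ : ℝ)) ^ (90 * k₁ ^ 3) * (2 * (k₂ : ℝ)) ^ (90 * k₂ ^ 3) *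
        Real.log m ^ (4 * k₁ ^ 2 + 4 * k₂ ^ 2) *
        ((√m * ((N₁ : ℝ) ^ (2 * k₁ * (k₂ - 1)) * G₁)) *
          (√m * ((N₂ : ℝ) ^ (2 * k₂ * (k₁ - 1)) * G₂))) := by
        rw [pow_add (Real.log m), mul_mul_mul_comm √(m : ℝ) _ √(m : ℝ),
          Real.mul_self_sqrt m_pos.le]
        ring
    _ = _ := by
        rw [factor₁, factor₂, mul_right_comm 2 k₂ k₁]
        ring

theorem rpow_pow_eq_pow {x e : ℝ} {d n : ℕ} (hx : 0 ≤ x) (h : e * d = n) : (x ^ e) ^ d = x ^ n := by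
  rw [← Real.rpow_mul_natCast hx, h, Real.rpow_natCast]

end BilinearKloosterman

theorem theorem3 (m : ℕ) (hm : 2 ≤ m) (a : ℤ) (ha : IsCoprime a (m : ℤ))
    (N₁ N₂ : ℕ) (hN₁ : 1 ≤ N₁) (hN₂ : 1 ≤ N₂)
    (k₁ k₂ : ℕ) (hk₁ : 1 ≤ k₁) (hk₂ : 1 ≤ k₂)
    (α₁ α₂ : ℕ → ℂ)
    (hα₁ : ∀ x ∈ Finset.Icc 1 N₁, ‖α₁ x‖ ≤ 1)
    (hα₂ : ∀ x ∈ Finset.Icc 1 N₂, ‖α₂ x‖ ≤ 1) :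
    ‖bilinearKloosterman m a N₁ N₂ α₁ α₂‖ <
      (2 * (k₁ : ℝ)) ^ (45 * (k₁ : ℝ) ^ 2 / (k₂ : ℝ)) *
      (2 * (k₂ : ℝ)) ^ (45 * (k₂ : ℝ) ^ 2 / (k₁ : ℝ)) *
      Real.log (m : ℝ) ^ (2 * ((k₁ : ℝ) / (k₂ : ℝ) + (k₂ : ℝ) / (k₁ : ℝ))) *
      ((N₁ : ℝ) ^ (k₁ - 1) / Real.sqrt m + Real.sqrt m / (N₁ : ℝ) ^ k₁) ^
        (1 / (2 * (k₁ : ℝ) * (k₂ : ℝ))) *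
      ((N₂ : ℝ) ^ (k₂ - 1) / Real.sqrt m + Real.sqrt m / (N₂ : ℝ) ^ k₂) ^
        (1 / (2 * (k₁ : ℝ) * (k₂ : ℝ))) *
      ((N₁ : ℝ) * (N₂ : ℝ)) := by
  have : (0 : ℝ) < k₁ := mod_cast hk₁
  have : (0 : ℝ) < k₂ := mod_cast hk₂
  have log_nonneg : 0 ≤ Real.log m := Real.log_natCast_nonneg m
  refine lt_of_pow_lt_pow_left₀ (2 * k₁ * k₂) (by positivity)
    ((norm_bilinearKloosterman_pow_lt hm ha hN₁ hN₂ hk₁ hk₂ hα₁ hα₂).trans_eq ?_)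
  simp only [mul_pow _ _ (2 * k₁ * k₂)]
  rw [rpow_pow_eq_pow (n := 90 * k₁ ^ 3) (by positivity) (by push_cast; field_simp; ring),
    rpow_pow_eq_pow (n := 90 * k₂ ^ 3) (by positivity) (by push_cast; field_simp; ring),
    rpow_pow_eq_pow (n := 4 * k₁ ^ 2 + 4 * k₂ ^ 2) log_nonneg (by push_cast; field_simp; ring),
    rpow_pow_eq_pow (n := 1) (by positivity) (by push_cast; field_simp),
    rpow_pow_eq_pow (n := 1) (by positivity) (by push_cast; field_simp), pow_one, pow_one]
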